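/- Fix an integer $d\ge 2$. For a positive integer $B$ and a set $V\subset\mathbb{R}^d$ let $$\mathrm{opt}_B(V)=\inf_{S}\Big\|\Big(\sum_{v\in S}vv^{\intercal}\Big)^{-1}\Big\|_2\in[0,\infty],$$ where $S$ ranges over all multisets of exactly $B$ elements of $V$ (repetitions allowed), $\|\cdot\|_2$ is the spectral norm, $\|A^{-1}\|_2=\infty$ for singular $A$, and $\inf\emptyset=\infty$. Thus $\mathrm{opt}_B$ is the optimal value of the experimental design problem with objective $A\mapsto\|A^{-1}\|_2=1/\lambda_{\min}(A)$ and budget $B$. A map $c$ that sends every finite set $V\subset\mathbb{R}^d$ to a subset $c(V)\subseteq V$ is called an $\alpha$-composable core-set for this problem, where $0\le\alpha<\infty$, if for every finite collection of finite sets $V_1,\dots,V_p\subset\mathbb{R}^d$ $$\mathrm{opt}_B\big(c(V_1)\cup\dots\cup c(V_p)\big)\le\alpha\cdot\mathrm{opt}_B\big(V_1\cup\dots\cup V_p\big)$$ (with the convention $0\cdot\infty=0$); it has size at most $t$ if $|c(V)|\le t$ for every finite $V\subset\mathbb{R}^d$. **Proposition.** There are universal constants $C>0$ and $\kappa>0$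 such that for every integer $d\ge2$, every real $\beta\ge1$, every integer $B\ge Cd$ and every $\alpha\ge 0$: if there is an $\alpha$-composable core-set of size at most $d^{\beta}$ for the experimental design problem in $\mathbb{R}^d$ with objective $A\mapsto\|A^{-1}\|_2$ and budget $B$, then $$\alpha\ \ge\ \kappa\,\frac{d}{\beta\,\log^2 d}.$$ -/

import Mathlib

open scoped ENNReal NNReal

noncomputable section

/-- The information matrix `∑_{v ∈ S} v vᵀ` of a multiset `S` of vectors of `ℝ^d`
(counted with multiplicity). -/
def infoMatrix {d : ℕ} (S : Multiset (EuclideanSpace ℝ (Fin d))) :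
    Matrix (Fin d) (Fin d) ℝ :=
  (S.map fun v => Matrix.vecMulVec v.ofLp v.ofLp).sum

/-- The optimal value of the experimental design problem with objective `f`, budget `B` and ground
set `V`: the infimum of `f (∑_{v ∈ S} v vᵀ)` over all multisets `S` of exactly `B` elements of `V`.
It is `∞` if there is no such multiset. -/
def designOpt {d : ℕ} (f : Matrix (Fin d) (Fin d) ℝ → ℝ≥0∞) (B : ℕ)
    (V : Set (EuclideanSpace ℝ (Fin d))) : ℝ≥0∞ :=
  ⨅ S : {S : Multiset (EuclideanSpace ℝ (Fin d)) // S.card = B ∧ ∀ v ∈ S, v ∈ V},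
    f (infoMatrix S.1)

/-- The objective `A ↦ ‖A⁻¹‖₂`, where `‖·‖₂` is the spectral norm, that is the operator norm with
respect to the Euclidean norm of `ℝ^d`; its value is `∞` at singular matrices. -/
def invSpectralNorm {d : ℕ} (A : Matrix (Fin d) (Fin d) ℝ) : ℝ≥0∞ :=
  if A.det = 0 then ∞ else ENNReal.ofReal ‖Matrix.toEuclideanCLM (𝕜 := ℝ) A⁻¹‖

/-- `c` is an `α`-composable core-set for the experimental design problem (a minimization problem)
with objective `f` and budget `B`: it maps every finite set of vectors to one of its subsets, and
for any finite collection of input sets, the optimum over the union of the core-sets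
is at most `α` times the optimum over the union of the input sets. -/
structure IsComposableCoreset {d : ℕ} (f : Matrix (Fin d) (Fin d) ℝ → ℝ≥0∞) (B : ℕ) (α : ℝ≥0)
    (c : Finset (EuclideanSpace ℝ (Fin d)) → Finset (EuclideanSpace ℝ (Fin d))) : Prop where
  subset : ∀ V, c V ⊆ V
  approx : ∀ (p : ℕ) (V : Fin p → Finset (EuclideanSpace ℝ (Fin d))),
    designOpt f B (⋃ i, (c (V i) : Set (EuclideanSpace ℝ (Fin d)))) ≤
      α * designOpt f B (⋃ i, (V i : Set (EuclideanSpace ℝ (Fin d))))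

end

open scoped InnerProductSpace

/-! Random signs give more than `d ^ β` unit vectors with pairwise squared inner products at most `μ
= 6 β log d / d` (`exists_nearly_orthogonal`). A core-set of size at most `d ^ β` must drop one of
them, say `v`. A second input of long vectors spanning the complement of `v` makes `v` the only
scarce direction: the full inputs reach smallest eigenvalue at least `B / 2`, whereas the quadratic
form at `v` of any design from the core-sets is at most `B μ`. Hence `α ≥ 1 / (2 μ) = d / (12 β log
d)` (`IsComposableCoreset.half_le_mul`), which beats the claim by a factor of order `log d`. -/

/-! ### Quadratic forms of information matrices -/

lemma inner_toEuclideanCLM_infoMatrix {d : ℕ} (S : Multiset (EuclideanSpace ℝ (Fin d)))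
    (x y : EuclideanSpace ℝ (Fin d)) :
    ⟪x, Matrix.toEuclideanCLM (𝕜 := ℝ) (infoMatrix S) y⟫_ℝ =
      (S.map fun v => ⟪v, x⟫_ℝ * ⟪v, y⟫_ℝ).sum := by
  induction S using Multiset.induction_on with
  | empty => simp [infoMatrix]
  | cons v S ih =>
    have h : infoMatrix (v ::ₘ S) = Matrix.vecMulVec v.ofLp v.ofLp + infoMatrix S := by
      simp [infoMatrix]
    have h' : Matrix.toEuclideanCLM (𝕜 := ℝ) (Matrix.vecMulVec v.ofLp v.ofLp) y = ⟪v, y⟫_ℝ • v := by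
      ext i
      simp [Matrix.ofLp_toEuclideanCLM, Matrix.vecMulVec_mulVec,
        EuclideanSpace.inner_eq_star_dotProduct, dotProduct_comm, mul_comm]
    rw [h, map_add, add_apply, inner_add_right, ih, h', inner_smul_right,
      Multiset.map_cons, Multiset.sum_cons, real_inner_comm x v, mul_comm]

lemma toEuclideanCLM_inv_apply {d : ℕ} {A : Matrix (Fin d) (Fin d) ℝ} (hA : A.det ≠ 0)
    (x : EuclideanSpace ℝ (Fin d)) :
    Matrix.toEuclideanCLM (𝕜 := ℝ) A (Matrix.toEuclideanCLM (𝕜 := ℝ) A⁻¹ x) = x := by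
  rw [← mul_apply_eq_comp, ← map_mul,
    Matrix.mul_nonsing_inv A (isUnit_iff_ne_zero.2 hA), map_one, one_apply_eq_self]

/-- The smallest eigenvalue of an information matrix is at most any value of its quadratic form
at a unit vector. -/
lemma ofReal_inv_le_invSpectralNorm {d : ℕ} (S : Multiset (EuclideanSpace ℝ (Fin d)))
    {v : EuclideanSpace ℝ (Fin d)} (hv : ‖v‖ = 1) {s : ℝ}
    (hs : (S.map fun u => ⟪u, v⟫_ℝ ^ 2).sum ≤ s) (hs0 : 0 < s) :
    ENNReal.ofReal s⁻¹ ≤ invSpectralNorm (infoMatrix S) := by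
  unfold invSpectralNorm
  split_ifs with hdet
  · exact le_top
  apply ENNReal.ofReal_le_ofReal
  set L := Matrix.toEuclideanCLM (𝕜 := ℝ) (infoMatrix S)
  set K := Matrix.toEuclideanCLM (𝕜 := ℝ) (infoMatrix S)⁻¹
  have hLK : L (K v) = v := toEuclideanCLM_inv_apply hdet v
  have hvv : ⟪v, v⟫_ℝ = 1 := by rw [real_inner_self_eq_norm_sq, hv]; norm_num
  have hform (x y) : ⟪x, L y⟫_ℝ = (S.map fun u => ⟪u, x⟫_ℝ * ⟪u, y⟫_ℝ).sum :=
    inner_toEuclideanCLM_infoMatrix S x y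
  have hnonneg (x) : 0 ≤ ⟪x, L x⟫_ℝ := by
    rw [hform]
    refine Multiset.sum_nonneg fun a ha => ?_
    obtain ⟨u, -, rfl⟩ := Multiset.mem_map.1 ha
    exact mul_self_nonneg _
  have hvLv : ⟪v, L v⟫_ℝ ≤ s := by
    rw [hform]; simpa only [pow_two] using hs
  have hcross : ⟪K v, L v⟫_ℝ = 1 := by
    rw [hform, ← hvv]
    conv_rhs => arg 3; rw [← hLK]
    rw [hform]
    simp only [mul_comm]
  -- Cauchy–Schwarz for the form of `L`: its value at `v - t • K v` is a nonnegative quadratic in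
  -- `t`.
  have hdisc : discrim ⟪v, K v⟫_ℝ (-2) ⟪v, L v⟫_ℝ ≤ 0 := by
    refine discrim_le_zero fun t => ?_
    have h := hnonneg (v - t • K v)
    rw [map_sub, map_smul, hLK, inner_sub_left, inner_sub_right, inner_sub_right, inner_smul_left,
      inner_smul_left, inner_smul_right, inner_smul_right, hcross, hvv, real_inner_comm v (K v)] at h
    simp only [conj_trivial] at h
    linarith
  have hKle : ⟪v, K v⟫_ℝ ≤ ‖K‖ := by
    calc ⟪v, K v⟫_ℝ ≤ ‖v‖ * ‖K v‖ := real_inner_le_norm _ _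
      _ ≤ ‖v‖ * (‖K‖ * ‖v‖) := by gcongr; exact K.le_opNorm v
      _ = ‖K‖ := by rw [hv]; ring
  have h1 : 1 ≤ ⟪v, K v⟫_ℝ * ⟪v, L v⟫_ℝ := by unfold discrim at hdisc; linarith
  rw [inv_le_iff_one_le_mul₀ hs0]
  calc 1 ≤ ⟪v, K v⟫_ℝ * ⟪v, L v⟫_ℝ := h1
    _ ≤ ‖K‖ * s := mul_le_mul hKle hvLv (hnonneg v) (norm_nonneg _)

/-- A lower bound for the quadratic form of an information matrix bounds its inverse. -/
lemma invSpectralNorm_le {d : ℕ} (S : Multiset (EuclideanSpace ℝ (Fin d))) {s : ℝ} (hs0 : 0 < s)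
    (hs : ∀ x, s * ‖x‖ ^ 2 ≤ (S.map fun u => ⟪u, x⟫_ℝ ^ 2).sum) :
    invSpectralNorm (infoMatrix S) ≤ ENNReal.ofReal s⁻¹ := by
  have hform (x) : s * ‖x‖ ^ 2 ≤ ⟪x, Matrix.toEuclideanCLM (𝕜 := ℝ) (infoMatrix S) x⟫_ℝ := by
    rw [inner_toEuclideanCLM_infoMatrix]; simpa only [pow_two] using hs x
  have hdet : (infoMatrix S).det ≠ 0 := by
    intro h
    obtain ⟨x, hx0, hx⟩ := Matrix.exists_mulVec_eq_zero_iff.2 h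
    have h0 : Matrix.toEuclideanCLM (𝕜 := ℝ) (infoMatrix S) (WithLp.toLp 2 x) = 0 := by
      rw [Matrix.toEuclideanCLM_toLp, hx]; rfl
    have h1 := hform (WithLp.toLp 2 x)
    rw [h0, inner_zero_right] at h1
    have h2 : WithLp.toLp 2 x ≠ 0 := by simpa using hx0
    have h3 := norm_pos_iff.2 h2
    have : 0 < s * ‖WithLp.toLp 2 x‖ ^ 2 := by positivity
    linarith
  unfold invSpectralNorm
  rw [if_neg hdet]
  apply ENNReal.ofReal_le_ofReal
  refine ContinuousLinearMap.opNorm_le_bound _ (by positivity) fun x => ?_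
  set y := Matrix.toEuclideanCLM (𝕜 := ℝ) (infoMatrix S)⁻¹ x with hy
  have h1 := hform y
  rw [hy, toEuclideanCLM_inv_apply hdet x, ← hy] at h1
  have h2 := real_inner_le_norm y x
  rw [inv_mul_eq_div, le_div_iff₀ hs0]
  rcases (norm_nonneg y).eq_or_lt with h | h
  · rw [← h]; simp
  · nlinarith

/-! ### From a dropped direction to a lower bound on the factor -/

/-- If a core-set retains only vectors nearly orthogonal to some unit vector of its input, its
approximation factor is large: complete the input by long vectors spanning the orthogonal
complement. -/
lemma IsComposableCoreset.half_le_mul {d B : ℕ} {α : ℝ≥0}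
    {c : Finset (EuclideanSpace ℝ (Fin d)) → Finset (EuclideanSpace ℝ (Fin d))}
    (hc : IsComposableCoreset invSpectralNorm B α c) (hd : 0 < d) (hB : 2 * d ≤ B)
    {V : Finset (EuclideanSpace ℝ (Fin d))} {v : EuclideanSpace ℝ (Fin d)} (hvV : v ∈ V)
    (hv : ‖v‖ = 1) {μ : ℝ} (hμ : 0 < μ) (hcv : ∀ u ∈ c V, ⟪u, v⟫_ℝ ^ 2 ≤ μ) :
    1 / 2 ≤ (α : ℝ) * μ := by
  classical
  obtain ⟨b, hb⟩ := Orthonormal.exists_orthonormalBasis_extension_of_card_eq (𝕜 := ℝ)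
    (E := EuclideanSpace ℝ (Fin d)) (ι := Fin d) (by simp) (v := fun _ => v) (s := {⟨0, hd⟩})
    (by
      rw [orthonormal_iff_ite]
      rintro ⟨i, hi⟩ ⟨j, hj⟩
      rw [Set.mem_singleton_iff] at hi hj
      subst hi hj
      simp [hv])
  set o : Fin d := ⟨0, hd⟩
  have hbo : b o = v := hb o rfl
  let W : Finset (EuclideanSpace ℝ (Fin d)) :=
    (Finset.univ.erase o).image fun i => (B : ℝ) • b i
  have hWv : ∀ u ∈ W, ⟪u, v⟫_ℝ = 0 := by
    intro u hu
    obtain ⟨i, hi, rfl⟩ := Finset.mem_image.1 hu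
    rw [inner_smul_left, ← hbo, b.orthonormal.2 (Finset.ne_of_mem_erase hi), mul_zero]
  have hBpos : (0 : ℝ) < B := by exact_mod_cast (by omega : 0 < B)
  have happ := hc.approx 2 ![V, W]
  have hlow : ENNReal.ofReal (B * μ)⁻¹ ≤
      designOpt invSpectralNorm B
        (⋃ i, (c (![V, W] i) : Set (EuclideanSpace ℝ (Fin d)))) := by
    refine le_iInf fun ⟨S, hS, hmem⟩ => ?_
    refine ofReal_inv_le_invSpectralNorm S hv ?_ (by positivity)
    have := Multiset.sum_le_card_nsmul (S.map fun u => ⟪u, v⟫_ℝ ^ 2) μ (by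
      intro a ha
      obtain ⟨u, hu, rfl⟩ := Multiset.mem_map.1 ha
      obtain ⟨i, hi⟩ := Set.mem_iUnion.1 (hmem u hu)
      fin_cases i
      · exact hcv u hi
      · rw [hWv u (hc.subset W hi)]
        simpa using hμ.le)
    simpa [hS] using this
  have hup : designOpt invSpectralNorm B
      (⋃ i, (![V, W] i : Set (EuclideanSpace ℝ (Fin d)))) ≤ ENNReal.ofReal ((B : ℝ) / 2)⁻¹ := by
    -- Each long vector is used once; at least half of the budget remains for `v`, since `2 * d ≤
    -- B`. The scaling by `B` makes the other directions harmless: `B ^ 2 ≥ B / 2`.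
    let S : Multiset (EuclideanSpace ℝ (Fin d)) :=
      Multiset.replicate (B - (d - 1)) v + (Finset.univ.erase o).val.map fun i => (B : ℝ) • b i
    have hcard : S.card = B := by
      simp [S]
      omega
    have hmem : ∀ u ∈ S, u ∈ ⋃ i, (![V, W] i : Set (EuclideanSpace ℝ (Fin d))) := by
      intro u hu
      rcases Multiset.mem_add.1 hu with hu | hu
      · rw [Multiset.eq_of_mem_replicate hu]
        exact Set.mem_iUnion.2 ⟨0, hvV⟩
      · obtain ⟨i, hi, rfl⟩ := Multiset.mem_map.1 hu
        exact Set.mem_iUnion.2 ⟨1, Finset.mem_image_of_mem _ hi⟩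
    refine (iInf_le _ ⟨S, hcard, hmem⟩).trans (invSpectralNorm_le S (by positivity) fun x => ?_)
    have hsum : (S.map fun u => ⟪u, x⟫_ℝ ^ 2).sum =
        ((B - (d - 1) : ℕ) : ℝ) * ⟪b o, x⟫_ℝ ^ 2 +
          ∑ i ∈ Finset.univ.erase o, (B : ℝ) ^ 2 * ⟪b i, x⟫_ℝ ^ 2 := by
      simp [S, hbo, Finset.sum, inner_smul_left, mul_pow]
    have hcoef : (B : ℝ) / 2 ≤ ((B - (d - 1) : ℕ) : ℝ) := by
      rw [div_le_iff₀ two_pos]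
      exact_mod_cast (by omega : B ≤ (B - (d - 1)) * 2)
    have hB1 : (1 : ℝ) ≤ B := by exact_mod_cast (by omega : 1 ≤ B)
    have hcoef' : (B : ℝ) / 2 ≤ (B : ℝ) ^ 2 := by nlinarith
    have hpars : ‖x‖ ^ 2 = ∑ i, ⟪b i, x⟫_ℝ ^ 2 := by
      rw [← b.sum_sq_norm_inner_right x]
      simp
    rw [hsum, hpars, ← Finset.add_sum_erase _ _ (Finset.mem_univ o), mul_add, Finset.mul_sum]
    gcongr
  have hfin : ENNReal.ofReal (B * μ)⁻¹ ≤ ENNReal.ofReal (α * ((B : ℝ) / 2)⁻¹) := by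
    rw [ENNReal.ofReal_mul α.coe_nonneg, ENNReal.ofReal_coe_nnreal]
    exact hlow.trans (happ.trans (by gcongr))
  rw [ENNReal.ofReal_le_ofReal_iff (by positivity), inv_le_iff_one_le_mul₀ (by positivity)] at hfin
  have : (α : ℝ) * ((B : ℝ) / 2)⁻¹ * (B * μ) = 2 * (α * μ) := by
    field_simp
  linarith

/-! ### Nearly orthogonal sign vectors -/

/-- Greedy choice of many pairwise unrelated elements. -/
lemma exists_finset_pairwise_not_rel {X : Type*} [Fintype X] [Nonempty X] [DecidableEq X]
    (r : X → X → Prop)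
    [DecidableRel r] (hrefl : ∀ x, r x x) (hsymm : ∀ x y, r x y → r y x) {K : ℝ}
    (hK : ∀ x, ((Finset.univ.filter (r x)).card : ℝ) ≤ K) (N : ℕ)
    (hN : N * K < Fintype.card X) :
    ∃ T : Finset X, T.card = N ∧ ∀ x ∈ T, ∀ y ∈ T, x ≠ y → ¬ r x y := by
  induction N with
  | zero => exact ⟨∅, by simp⟩
  | succ N ih =>
    have hN' : N * K < Fintype.card X := by
      have hK0 : 0 ≤ K := (Nat.cast_nonneg _).trans (hK (Classical.arbitrary X))
      push_cast at hN
      linarith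
    obtain ⟨T, hT, hpair⟩ := ih hN'
    have hcard : (T.biUnion fun x => Finset.univ.filter (r x)).card < Fintype.card X := by
      have h1 : ((T.biUnion fun x => Finset.univ.filter (r x)).card : ℝ) ≤ N * K := by
        calc ((T.biUnion fun x => Finset.univ.filter (r x)).card : ℝ)
            ≤ ∑ x ∈ T, ((Finset.univ.filter (r x)).card : ℝ) := by
              exact_mod_cast Finset.card_biUnion_le
          _ ≤ ∑ _x ∈ T, K := Finset.sum_le_sum fun x _ => hK x
          _ = N * K := by simp [hT]
      exact_mod_cast h1.trans_lt hN'
    obtain ⟨y, hy⟩ : ∃ y, y ∉ T.biUnion fun x => Finset.univ.filter (r x) := by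
      by_contra! h
      rw [Finset.eq_univ_iff_forall.2 h] at hcard
      simp at hcard
    have hy' : ∀ x ∈ T, ¬ r x y := fun x hx hr =>
      hy (Finset.mem_biUnion.2 ⟨x, hx, by simpa using hr⟩)
    have hyT : y ∉ T := fun h => hy' y h (hrefl y)
    refine ⟨insert y T, by rw [Finset.card_insert_of_notMem hyT, hT], ?_⟩
    intro x hx z hz hxz
    rcases Finset.mem_insert.1 hx with rfl | hxT <;> rcases Finset.mem_insert.1 hz with rfl | hzT
    · exact absurd rfl hxz
    · exact fun h => hy' z hzT (hsymm _ _ h)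
    · exact hy' x hxT
    · exact hpair x hxT z hzT hxz

/-- Moment generating function of the correlation of a random sign vector with a fixed one. -/
lemma sum_exp_signs_le {d : ℕ} (u : Fin d → ℤˣ) (l : ℝ) :
    ∑ w : Fin d → ℤˣ, Real.exp (l * ∑ i, ((u i : ℤ) : ℝ) * ((w i : ℤ) : ℝ)) ≤
      2 ^ d * Real.exp (d * l ^ 2 / 2) := by
  have h1 : ∑ w : Fin d → ℤˣ, Real.exp (l * ∑ i, ((u i : ℤ) : ℝ) * ((w i : ℤ) : ℝ)) =
      ∏ i, ∑ e : ℤˣ, Real.exp (l * (((u i : ℤ) : ℝ) * ((e : ℤ) : ℝ))) := by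
    rw [Finset.prod_univ_sum, Fintype.piFinset_univ]
    refine Finset.sum_congr rfl fun w _ => ?_
    rw [Finset.mul_sum, Real.exp_sum]
  have h2 (i : Fin d) : ∑ e : ℤˣ, Real.exp (l * (((u i : ℤ) : ℝ) * ((e : ℤ) : ℝ))) =
      2 * Real.cosh l := by
    rw [Real.cosh_eq, show (Finset.univ : Finset ℤˣ) = {1, -1} from rfl,
      Finset.sum_pair (by decide)]
    rcases Int.units_eq_one_or (u i) with h | h <;> simp [h] <;> ring
  rw [h1, Finset.prod_congr rfl fun i _ => h2 i, Finset.prod_const, Finset.card_univ,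
    Fintype.card_fin, mul_pow]
  have h3 : Real.cosh l ^ d ≤ Real.exp (l ^ 2 / 2) ^ d :=
    pow_le_pow_left₀ (Real.cosh_pos l).le (Real.cosh_le_exp_half_sq l) d
  rw [← Real.exp_nat_mul] at h3
  rw [mul_div_assoc]
  gcongr

/-- Two-sided Chernoff bound: the exponential moments at `l` and `-l` control both tails. -/
lemma card_correlated_signs_le {d : ℕ} (hd : 0 < d) (u : Fin d → ℤˣ) {τ : ℝ} (hτ : 0 ≤ τ) :
    ((Finset.univ.filter fun w : Fin d → ℤˣ =>
        τ ≤ |∑ i, ((u i : ℤ) : ℝ) * ((w i : ℤ) : ℝ)|).card : ℝ) ≤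
      2 * 2 ^ d * Real.exp (-(τ ^ 2 / (2 * d))) := by
  set s : (Fin d → ℤˣ) → ℝ := fun w => ∑ i, ((u i : ℤ) : ℝ) * ((w i : ℤ) : ℝ)
  have hd' : (0 : ℝ) < d := by exact_mod_cast hd
  -- This `l` minimises the exponent `d * l ^ 2 / 2 - l * τ`.
  set l : ℝ := τ / d
  have hl0 : 0 ≤ l := by positivity
  set F := Finset.univ.filter fun w : Fin d → ℤˣ => τ ≤ |s w|
  have h1 : (F.card : ℝ) * Real.exp (l * τ) ≤ 2 * (2 ^ d * Real.exp (d * l ^ 2 / 2)) := by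
    calc (F.card : ℝ) * Real.exp (l * τ) = ∑ _w ∈ F, Real.exp (l * τ) := by simp
      _ ≤ ∑ w ∈ F, (Real.exp (l * s w) + Real.exp (-l * s w)) := by
        refine Finset.sum_le_sum fun w hw => ?_
        have hw' : τ ≤ |s w| := (Finset.mem_filter.1 hw).2
        rcases le_abs.1 hw' with h | h
        · have := Real.exp_le_exp.2 (mul_le_mul_of_nonneg_left h hl0)
          linarith [Real.exp_pos (-l * s w)]
        · have := Real.exp_le_exp.2 (mul_le_mul_of_nonneg_left h hl0)
          rw [mul_neg, ← neg_mul] at this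
          linarith [Real.exp_pos (l * s w)]
      _ ≤ ∑ w, (Real.exp (l * s w) + Real.exp (-l * s w)) :=
        Finset.sum_le_sum_of_subset_of_nonneg (Finset.subset_univ _) fun _ _ _ => by positivity
      _ ≤ 2 * (2 ^ d * Real.exp (d * l ^ 2 / 2)) := by
        rw [Finset.sum_add_distrib]
        have h := sum_exp_signs_le u l
        have h' := sum_exp_signs_le u (-l)
        rw [neg_sq] at h'
        linarith
  rw [← le_div_iff₀ (Real.exp_pos _)] at h1
  refine h1.trans_eq ?_
  rw [← mul_assoc, mul_div_assoc, ← Real.exp_sub]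
  congr 2
  simp only [l]
  field_simp
  ring

/-- There are more than `d ^ β` nearly orthogonal unit vectors in `ℝ^d`. -/
lemma exists_nearly_orthogonal {d : ℕ} (hd : 2 ≤ d) {β : ℝ} (hβ : 1 ≤ β)
    (h : 6 * β * Real.log d ≤ d) :
    ∃ V : Finset (EuclideanSpace ℝ (Fin d)), (d : ℝ) ^ β < V.card ∧ (∀ v ∈ V, ‖v‖ = 1) ∧
      ∀ u ∈ V, ∀ v ∈ V, u ≠ v → ⟪u, v⟫_ℝ ^ 2 ≤ 6 * β * Real.log d / d := by
  classical
  have hd2 : (2 : ℝ) ≤ d := by exact_mod_cast hd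
  have hd0 : (0 : ℝ) < d := by linarith
  have hlog : 0 ≤ Real.log d := Real.log_nonneg (by linarith)
  set τ : ℝ := √(6 * β * Real.log d * d) with hτ
  have hτsq : τ ^ 2 = 6 * β * Real.log d * d := Real.sq_sqrt (by positivity)
  have hτd : τ ≤ d := by
    rw [hτ]
    -- `τ ≤ d` is what makes the relation `τ ≤ |s u w|` reflexive.
    apply Real.sqrt_le_iff.2
    exact ⟨hd0.le, by nlinarith⟩
  let s : (Fin d → ℤˣ) → (Fin d → ℤˣ) → ℝ := fun u w => ∑ i, ((u i : ℤ) : ℝ) * ((w i : ℤ) : ℝ)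
  have hself (u : Fin d → ℤˣ) : s u u = d := by
    have (i : Fin d) : ((u i : ℤ) : ℝ) * ((u i : ℤ) : ℝ) = 1 := by
      rcases Int.units_eq_one_or (u i) with h | h <;> simp [h]
    simp [s, this]
  set P : ℝ := (d : ℝ) ^ β with hP
  have hP2 : 2 ≤ P := hd2.trans (Real.self_le_rpow_of_one_le (by linarith) hβ)
  obtain ⟨T, hTcard, hT⟩ := exists_finset_pairwise_not_rel (fun u w => τ ≤ |s u w|)
    (fun u => by rw [hself, abs_of_nonneg hd0.le]; exact hτd)
    (fun u w huw => by simpa only [s, mul_comm] using huw)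
    -- The tail `exp (-τ ^ 2 / (2 d))` equals `d ^ (-3 β) = P⁻³`. Greedy selection then succeeds
    -- because `2 (P + 1) < P ^ 3` for `P ≥ 2`.
    (K := 2 * 2 ^ d * (P ^ 3)⁻¹)
    (fun u => by
      refine (card_correlated_signs_le (by omega) u (Real.sqrt_nonneg _)).trans_eq ?_
      congr 1
      rw [hτsq, hP, ← Real.rpow_natCast, ← Real.rpow_mul hd0.le, ← Real.rpow_neg hd0.le,
        Real.rpow_def_of_pos hd0]
      congr 1
      push_cast
      field_simp
      ring)
    (⌊P⌋₊ + 1) (by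
      have hfl := Nat.floor_le (by linarith : 0 ≤ P)
      have hcard : (Fintype.card (Fin d → ℤˣ) : ℝ) = 2 ^ d := by simp
      rw [hcard, ← div_eq_mul_inv, ← mul_div_assoc, div_lt_iff₀ (by positivity)]
      push_cast
      have h1 : ((⌊P⌋₊ : ℝ) + 1) * 2 < P ^ 3 := by nlinarith [mul_pos (by linarith : 0 < P) (by linarith : 0 < P)]
      nlinarith [pow_pos (two_pos : (0 : ℝ) < 2) d])
  let g : (Fin d → ℤˣ) → EuclideanSpace ℝ (Fin d) :=
    fun u => (√d)⁻¹ • WithLp.toLp 2 fun i => ((u i : ℤ) : ℝ)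
  have hsq : (√(d : ℝ))⁻¹ * (√(d : ℝ))⁻¹ = (d : ℝ)⁻¹ := by
    rw [← mul_inv, Real.mul_self_sqrt hd0.le]
  have hg (u w) : ⟪g u, g w⟫_ℝ = s u w / d := by
    simp only [g, inner_smul_left, inner_smul_right, PiLp.inner_apply]
    simp only [← mul_assoc, conj_trivial, hsq, s, div_eq_inv_mul]
    simp [mul_comm]
  have hginj : Function.Injective g := by
    intro u w huw
    have h0 : (√(d : ℝ))⁻¹ ≠ 0 := by positivity
    have h1 := WithLp.toLp_injective 2 (smul_right_injective _ h0 huw)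
    funext i
    have h2 := congrFun h1 i
    exact Units.ext (by exact_mod_cast h2)
  refine ⟨T.image g, ?_, ?_, ?_⟩
  · rw [Finset.card_image_of_injective _ hginj, hTcard]
    exact_mod_cast Nat.lt_floor_add_one P
  · intro v hv
    obtain ⟨u, -, rfl⟩ := Finset.mem_image.1 hv
    have h1 := real_inner_self_eq_norm_sq (g u)
    rw [hg, hself, div_self hd0.ne'] at h1
    exact (pow_eq_one_iff_of_nonneg (norm_nonneg _) two_ne_zero).1 h1.symm
  · intro u hu v hv huv
    obtain ⟨u, huT, rfl⟩ := Finset.mem_image.1 hu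
    obtain ⟨v, hvT, rfl⟩ := Finset.mem_image.1 hv
    have h1 := (not_le.1 (hT u huT v hvT fun h => huv (h ▸ rfl))).le
    have h2 : s u v ^ 2 ≤ τ ^ 2 := sq_le_sq.2 (h1.trans (le_abs_self _))
    rw [hg, div_pow, div_le_div_iff₀ (by positivity) hd0]
    rw [hτsq] at h2
    nlinarith

/-! ### The lower bound -/

theorem mainTheorem11 :
    ∃ C κ : ℝ, 0 < C ∧ 0 < κ ∧
      ∀ (d : ℕ) (β : ℝ) (B : ℕ) (α : ℝ≥0)
        (c : Finset (EuclideanSpace ℝ (Fin d)) → Finset (EuclideanSpace ℝ (Fin d))),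
        2 ≤ d → 1 ≤ β → C * (d : ℝ) ≤ (B : ℝ) →
        IsComposableCoreset invSpectralNorm B α c →
        (∀ V, ((c V).card : ℝ) ≤ (d : ℝ) ^ β) →
        κ * ((d : ℝ) / (β * Real.log (d : ℝ) ^ 2)) ≤ (α : ℝ) := by
  refine ⟨2, 1 / 24, by norm_num, by norm_num, fun d β B α c hd hβ hB hc hcard => ?_⟩
  have hB' : 2 * d ≤ B := by exact_mod_cast hB
  have hd2 : (2 : ℝ) ≤ d := by exact_mod_cast hd
  have hd0 : (0 : ℝ) < d := by linarith
  -- This absorbs the extra logarithm: `1 / (24 L ^ 2) ≤ 1 / (12 L)` exactly when `L ≥ 1 / 2`.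
  have hlog : 1 / 2 ≤ Real.log d :=
    (by linarith [Real.log_two_gt_d9] : 1 / 2 ≤ Real.log 2).trans
      (Real.log_le_log two_pos hd2)
  set L := Real.log d
  have hβL : 0 < β * L := by positivity
  suffices h : (d : ℝ) / (12 * (β * L)) ≤ α by
    refine le_trans ?_ h
    rw [← mul_div_assoc, div_le_div_iff₀ (by positivity) (by positivity)]
    have : 0 ≤ d * (β * L) := by positivity
    nlinarith
  rw [div_le_iff₀ (by positivity)]
  rcases le_total (6 * β * L) d with h | h
  · obtain ⟨V, hV, hunit, horth⟩ := exists_nearly_orthogonal hd hβ h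
    obtain ⟨v, hvV, hvc⟩ : ∃ v ∈ V, v ∉ c V := by
      by_contra! hsub
      have : (V.card : ℝ) ≤ (c V).card := by exact_mod_cast Finset.card_le_card hsub
      linarith [hcard V]
    have := hc.half_le_mul (by omega) hB' hvV (hunit v hvV) (μ := 6 * β * L / d) (by positivity)
      fun u hu => horth u (hc.subset V hu) v hvV fun h => hvc (h ▸ hu)
    rw [← mul_div_assoc, le_div_iff₀ hd0] at this
    linarith
  -- For large `β` the goal follows from `α ≥ 1 / 2`, which a single unit vector with `μ = 1`
  -- already forces.
  · have hv : ‖EuclideanSpace.single (⟨0, by omega⟩ : Fin d) (1 : ℝ)‖ = 1 := by simp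
    have := hc.half_le_mul (by omega) hB' (Finset.mem_singleton_self _) hv one_pos fun u hu => by
      rw [Finset.mem_singleton.1 (hc.subset _ hu), real_inner_self_eq_norm_sq, hv]
      norm_num
    nlinarith
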